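/- Let $\mathbb{D}$ be the open unit disc in $\mathbb{C}$, let $\alpha>-1$ and let $H$ be a nonzero separable complex Hilbert space. Let $\mathcal{A}^2_\alpha(H)$ be the Hilbert space of all analytic functions $f:\mathbb{D}\to H$ (that is, $f(z)=\sum_{n\ge 0}y_nz^n$ on $\mathbb{D}$ with $y_n\in H$) such that $$\|f\|^2=\int_{\mathbb{D}}\|f(z)\|^2\,dA_\alpha(z)<\infty,\qquad dA_\alpha(z)=(\alpha+1)(1-|z|^2)^\alpha\,dA(z),$$ where $dA$ is the area measure on $\mathbb{D}$ normalized to have total mass $1$, with the inner product $\langle f,g\rangle=\int_{\mathbb{D}}\langle f(z),g(z)\rangle\,dA_\alpha(z)$. For an analytic self-map $\Phi:\mathbb{D}\to\mathbb{D}$ let $C_\Phi$ be the composition operator $C_\Phi f=f\circ\Phi$, which is a bounded linear operator on $\mathcal{A}^2_\alpha(H)$. A bounded operator $T$ on a Hilbert space is called a co-isometry if $TT^*=I$, and unitary if $TT^*=T^*T=I$. Then for every analytic self-map $\Phi$ of $\mathbb{D}$: (a) $C_\Phi$ is unitary on $\mathcal{A}^2_\alpha(H)$ if and only if there is $\lambda\in\mathbb{C}$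 with $|\lambda|=1$ such that $\Phi(z)=\lambda z$ for all $z\in\mathbb{D}$; (b) $C_\Phi$ is a co-isometry on $\mathcal{A}^2_\alpha(H)$ if and only if it is unitary. -/

import Mathlib

noncomputable section

namespace Bergman

open MeasureTheory Complex Filter Topology
open scoped ENNReal NNReal

/-- The open unit disc `𝔻`. -/
abbrev Disc : Type := ↥(Metric.ball (0 : ℂ) 1)

/-- A function `f` on the disc with values in a complex normed space is analytic if
`f z = ∑ yₙ zⁿ` for all `z` in the disc. -/
def IsAnalytic {X : Type*} [NormedAddCommGroup X] [NormedSpace ℂ X] (f : Disc → X) : Prop :=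
  ∃ y : ℕ → X, ∀ z : Disc, HasSum (fun n : ℕ => (z : ℂ) ^ n • y n) (f z)

/-- The density `(α + 1) / π * (1 - |z|²) ^ α` of `dA_α` with respect to Lebesgue measure. -/
def weight (α : ℝ) (z : ℂ) : ℝ := (α + 1) / Real.pi * (1 - ‖z‖ ^ 2) ^ α

/-- The measure `dA_α = (α + 1) (1 - |z|²) ^ α dA` on the disc, where `dA` is the area measure
divided by `π`. -/
def areaMeasure (α : ℝ) : Measure Disc :=
  ((volume : Measure ℂ).withDensity fun z => ENNReal.ofReal (weight α z)).comap Subtype.val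

section aux

variable {X : Type*} [NormedAddCommGroup X] [NormedSpace ℂ X]

open Classical in
/-- Extension by zero to the plane. -/
def extend (f : Disc → X) (w : ℂ) : X :=
  if h : w ∈ Metric.ball (0 : ℂ) 1 then f ⟨w, h⟩ else 0

theorem extend_coe (f : Disc → X) (z : Disc) : extend f z = f z := by
  have := z.2
  simp only [extend, this, dite_true]

theorem IsAnalytic.differentiableOn [CompleteSpace X] {f : Disc → X} (hf : IsAnalytic f) :
    DifferentiableOn ℂ (extend f) (Metric.ball 0 1) := by
  obtain ⟨y, hy⟩ := hf
  have hb : Metric.eball (0 : ℂ) 1 = Metric.ball 0 1 := by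
    rw [← ENNReal.ofReal_one, Metric.eball_ofReal]
  have key : HasFPowerSeriesOnBall (extend f)
      (fun n => ContinuousMultilinearMap.mkPiRing ℂ (Fin n) (y n)) 0 1 := by
    refine ⟨?_, by simp, ?_⟩
    · refine ENNReal.le_of_forall_nnreal_lt fun r hr => ?_
      have hr1 : r < 1 := by exact_mod_cast hr
      refine FormalMultilinearSeries.le_radius_of_tendsto (l := 0) _ ?_
      have h1 := (hy ⟨(r : ℂ), by simpa using hr1⟩).summable.tendsto_atTop_zero.norm
      rw [norm_zero] at h1
      refine h1.congr fun n => ?_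
      simp [norm_smul, mul_comm]
    · intro w hw
      have hw' : w ∈ Metric.ball (0 : ℂ) 1 := hb ▸ hw
      have h1 := hy ⟨w, hw'⟩
      rw [zero_add, show extend f w = f ⟨w, hw'⟩ from extend_coe f ⟨w, hw'⟩]
      simpa using h1
  exact hb ▸ key.differentiableOn

theorem isAnalytic_of_differentiableOn [CompleteSpace X] {f : Disc → X} {F : ℂ → X}
    (hF : DifferentiableOn ℂ F (Metric.ball 0 1)) (h : ∀ z : Disc, F z = f z) :
    IsAnalytic f := by
  refine ⟨fun n => (n.factorial : ℂ)⁻¹ • iteratedDeriv n F 0, fun z => ?_⟩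
  have := Complex.hasSum_taylorSeries_on_ball hF z.2
  rw [h] at this
  refine this.congr_fun fun n => ?_
  rw [sub_zero, smul_comm]

theorem IsAnalytic.continuous [CompleteSpace X] {f : Disc → X} (hf : IsAnalytic f) :
    Continuous f := by
  have := continuousOn_iff_continuous_domRestrict.1 hf.differentiableOn.continuousOn
  exact this.congr fun z => extend_coe f z

theorem lintegral_areaMeasure (α : ℝ) (φ : ℂ → ℝ≥0∞) :
    ∫⁻ z : Disc, φ z ∂areaMeasure α =
      ∫⁻ w in Metric.ball (0 : ℂ) 1, ENNReal.ofReal (weight α w) * φ w := by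
  have hm : Measurable fun w : ℂ => ENNReal.ofReal (weight α w) := by
    unfold weight; fun_prop
  rw [areaMeasure, lintegral_subtype_comap Metric.isOpen_ball.measurableSet,
    restrict_withDensity Metric.isOpen_ball.measurableSet,
    lintegral_withDensity_eq_lintegral_mul_non_measurable _ hm (by simp)]
  rfl

theorem exists_weight_lower {α : ℝ} (hα : -1 < α) {s : ℝ} (hs0 : 0 ≤ s) (hs : s < 1) :
    ∃ c : ℝ≥0, 0 < c ∧ ∀ w : ℂ, ‖w‖ ≤ s → (c : ℝ≥0∞) ≤ ENNReal.ofReal (weight α w) := by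
  have hs2 : 0 < 1 - s ^ 2 := by nlinarith
  have hp : 0 < (α + 1) / Real.pi := div_pos (by linarith) Real.pi_pos
  refine ⟨Real.toNNReal ((α + 1) / Real.pi * min 1 ((1 - s ^ 2) ^ α)), ?_, fun w hw => ?_⟩
  · rw [Real.toNNReal_pos]
    have := Real.rpow_pos_of_pos hs2 α
    positivity
  · rw [← ENNReal.ofReal]
    refine ENNReal.ofReal_le_ofReal (mul_le_mul_of_nonneg_left ?_ hp.le)
    have hw2 : ‖w‖ ^ 2 ≤ s ^ 2 := by gcongr
    rcases le_total 0 α with h | h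
    · exact (min_le_right _ _).trans (Real.rpow_le_rpow hs2.le (by linarith) h)
    · refine (min_le_left _ _).trans
        (Real.one_le_rpow_of_pos_of_le_one_of_nonpos (by linarith) ?_ h)
      nlinarith [sq_nonneg ‖w‖]

theorem sq_setLIntegral_le {μ : Measure ℂ} {g : ℂ → ℝ≥0∞} (hg : Measurable g) (B : Set ℂ) :
    (∫⁻ w in B, g w ∂μ) ^ 2 ≤ μ B * ∫⁻ w in B, g w ^ 2 ∂μ := by
  have h := ENNReal.lintegral_mul_le_Lp_mul_Lq (μ.restrict B) Real.HolderConjugate.two_two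
    (f := fun _ => 1) (g := g) aemeasurable_const hg.aemeasurable
  simp only [Pi.mul_apply, one_mul, lintegral_const, one_pow,
    Measure.restrict_apply_univ, ENNReal.rpow_ofNat] at h
  calc (∫⁻ w in B, g w ∂μ) ^ 2
      ≤ ((μ B) ^ (1 / 2 : ℝ) * (∫⁻ w in B, g w ^ 2 ∂μ) ^ (1 / 2 : ℝ)) ^ 2 := by gcongr
    _ = _ := by
      rw [mul_pow, ← ENNReal.rpow_natCast, ← ENNReal.rpow_natCast, ← ENNReal.rpow_mul,
        ← ENNReal.rpow_mul]
      norm_num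

/-- The mean value inequality over a disc. -/
theorem mean_value_le [CompleteSpace X] {F : ℂ → X}
    (hF : DifferentiableOn ℂ F (Metric.ball 0 1)) {g : ℂ → ℝ≥0∞} (hg : Measurable g)
    (hFg : ∀ w ∈ Metric.ball (0 : ℂ) 1, ‖F w‖ₑ = g w) {z : ℂ} {ρ : ℝ} 
    (hz : Metric.ball z ρ ⊆ Metric.ball 0 1) :
    volume (Metric.ball (0 : ℂ) ρ) * ‖F z‖ₑ ≤ ∫⁻ w in Metric.ball z ρ, g w := by
  set h : ℂ → ℝ≥0∞ := (Metric.ball z ρ).indicator g with hh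
  have hm : Measurable h := hg.indicator Metric.isOpen_ball.measurableSet
  have hball : ∀ w : ℂ, ∀ ζ : ℂ, ‖w‖ < ρ → ‖ζ‖ ≤ 1 → z + ζ * w ∈ Metric.ball z ρ := by
    intro w ζ hw hζ
    rw [mem_ball_iff_norm, add_sub_cancel_left, norm_mul]
    nlinarith [norm_nonneg w]
  have hpt : ∀ w : ℂ, (Metric.ball (0 : ℂ) ρ).indicator
      (fun _ => ENNReal.ofReal (2 * Real.pi) * ‖F z‖ₑ) w ≤
      ∫⁻ θ in Set.Ioc 0 (2 * Real.pi), h (z + circleMap 0 1 θ * w) := by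
    intro w
    by_cases hw : w ∈ Metric.ball (0 : ℂ) ρ
    · rw [Set.indicator_of_mem hw]
      have hw' : ‖w‖ < ρ := by simpa using hw
      have hd : DiffContOnCl ℂ (fun ζ : ℂ => F (z + ζ * w)) (Metric.ball 0 |1|) := by
        refine DifferentiableOn.diffContOnCl ?_
        rw [abs_one, closure_ball _ one_ne_zero]
        refine hF.comp (by fun_prop) fun ζ hζ => hz (hball w ζ hw' (by simpa using hζ))
      have h1 := hd.circleAverage
      rw [zero_mul, add_zero, Real.circleAverage_def, inv_smul_eq_iff₀ (by positivity)] at h1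
      have h2 : ENNReal.ofReal (2 * Real.pi) * ‖F z‖ₑ = ‖(2 * Real.pi) • F z‖ₑ := by
        rw [enorm_smul, Real.enorm_eq_ofReal (by positivity)]
      rw [h2, ← h1, intervalIntegral.integral_of_le (by positivity)]
      refine (enorm_integral_le_lintegral_enorm _).trans (lintegral_mono fun θ => ?_)
      have hin := hball w (circleMap 0 1 θ) hw' (by simp)
      rw [hh, Set.indicator_of_mem hin, hFg _ (hz hin)]
    · rw [Set.indicator_of_notMem hw]; exact bot_le
  have hI : ∫⁻ w in Metric.ball z ρ, g w = ∫⁻ w, h w :=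
    (lintegral_indicator Metric.isOpen_ball.measurableSet _).symm
  have h3 := lintegral_mono (μ := volume) hpt
  rw [lintegral_indicator Metric.isOpen_ball.measurableSet, setLIntegral_const,
    lintegral_lintegral_swap (by
      refine Measurable.aemeasurable (hm.comp ?_)
      fun_prop)] at h3
  have h4 : ∀ θ : ℝ, ∫⁻ w, h (z + circleMap 0 1 θ * w) = ∫⁻ w, h w := by
    intro θ
    have e := (rotation (Circle.exp θ)).measurePreserving.lintegral_comp
      (hm.comp (measurable_const_add z))
    simp only [Function.comp_apply, rotation_apply, Circle.coe_exp] at e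
    rw [lintegral_add_left_eq_self h z] at e
    simpa [circleMap] using e
  simp only [h4, setLIntegral_const, Real.volume_Ioc, sub_zero] at h3
  rw [hI]
  have h5 : ENNReal.ofReal (2 * Real.pi) ≠ 0 := by simp [Real.pi_pos]
  refine (ENNReal.mul_le_mul_iff_right h5 ENNReal.ofReal_ne_top).1 ?_
  calc _ = _ := by ring
    _ ≤ _ := h3
    _ = _ := by ring

/-- Point evaluations are locally uniformly bounded. -/
theorem exists_point_bound [CompleteSpace X] {α : ℝ} (hα : -1 < α) {r : ℝ} (hr0 : 0 ≤ r)
    (hr : r < 1) : ∃ C : ℝ≥0, ∀ f : Disc → X, IsAnalytic f → ∀ z : Disc, ‖(z : ℂ)‖ ≤ r →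
      ‖f z‖ₑ ^ 2 ≤ C * ∫⁻ w, ‖f w‖ₑ ^ 2 ∂areaMeasure α := by
  obtain ⟨c, hc, hcw⟩ := exists_weight_lower hα (s := (1 + r) / 2) (by linarith) (by linarith)
  set ρ := (1 - r) / 2 with hρ
  have hρ0 : 0 < ρ := by rw [hρ]; linarith
  set V : ℝ≥0∞ := volume (Metric.ball (0 : ℂ) ρ) with hV
  have hVt : V ≠ ⊤ := measure_ball_lt_top.ne
  have hV0 : V ≠ 0 := (Metric.measure_ball_pos volume 0 hρ0).ne'
  have hc0 : (c : ℝ≥0∞) ≠ 0 := by simpa using hc.ne'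
  refine ⟨(V⁻¹ * (c : ℝ≥0∞)⁻¹).toNNReal, fun f hf z hz => ?_⟩
  rw [ENNReal.coe_toNNReal (ENNReal.mul_ne_top (by simpa using hV0) (ENNReal.inv_ne_top.2 hc0))]
  have hsub : Metric.ball (z : ℂ) ρ ⊆ Metric.closedBall 0 ((1 + r) / 2) := by
    intro w hw
    rw [mem_ball_iff_norm] at hw
    rw [mem_closedBall_zero_iff]
    have := norm_le_norm_sub_add w z
    linarith
  have hsub1 : Metric.ball (z : ℂ) ρ ⊆ Metric.ball 0 1 :=
    hsub.trans (Metric.closedBall_subset_ball (by linarith))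
  set g : ℂ → ℝ≥0∞ := fun w => ‖extend f w‖ₑ with hgd
  have hg : Measurable g := by
    classical
    have h0 : g = (Metric.ball (0 : ℂ) 1).piecewise g 0 := by
      funext w
      by_cases hw : w ∈ Metric.ball (0 : ℂ) 1
      · simp [Set.piecewise, hw]
      · simp only [Set.piecewise, hw, if_false, hgd, extend, dite_false, enorm_zero,
          Pi.zero_apply]
    rw [h0]
    exact ContinuousOn.measurable_piecewise hf.differentiableOn.continuousOn.enorm
      continuousOn_const Metric.isOpen_ball.measurableSet
  have h1 := mean_value_le hf.differentiableOn hg (fun w _ => rfl) hsub1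
  rw [extend_coe] at h1
  have h2 := sq_setLIntegral_le (μ := volume) hg (Metric.ball (z : ℂ) ρ)
  have h3 : volume (Metric.ball (z : ℂ) ρ) = V := by
    rw [hV]; simp [Complex.volume_ball]
  have h4 : c * ∫⁻ w in Metric.ball (z : ℂ) ρ, g w ^ 2 ≤
      ∫⁻ w, ‖f w‖ₑ ^ 2 ∂areaMeasure α := by
    have := lintegral_areaMeasure α fun w => g w ^ 2
    simp only [hgd, extend_coe] at this
    rw [this, ← lintegral_const_mul _ (hg.pow_const 2)]
    refine (setLIntegral_mono_ae' Metric.isOpen_ball.measurableSet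
      (.of_forall fun w hw => ?_)).trans (lintegral_mono_set hsub1)
    gcongr
    exact hcw w (by simpa using hsub hw)
  rw [h3] at h2
  have h5 : V ^ 2 * ‖f z‖ₑ ^ 2 ≤ V * ∫⁻ w in Metric.ball (z : ℂ) ρ, g w ^ 2 := by
    rw [← mul_pow]
    exact le_trans (by gcongr) h2
  have h6 : V * ‖f z‖ₑ ^ 2 ≤ ∫⁻ w in Metric.ball (z : ℂ) ρ, g w ^ 2 := by
    refine (ENNReal.mul_le_mul_iff_right hV0 hVt).1 ?_
    rwa [← mul_assoc, ← sq]
  have h7 : c * V * ‖f z‖ₑ ^ 2 ≤ ∫⁻ w, ‖f w‖ₑ ^ 2 ∂areaMeasure α := by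
    refine le_trans ?_ h4
    rw [mul_assoc]
    gcongr
  calc ‖f z‖ₑ ^ 2 = V⁻¹ * (c : ℝ≥0∞)⁻¹ * (c * V * ‖f z‖ₑ ^ 2) := by
        rw [show V⁻¹ * (c : ℝ≥0∞)⁻¹ * (c * V * ‖f z‖ₑ ^ 2) =
          (V⁻¹ * V) * ((c : ℝ≥0∞)⁻¹ * c) * ‖f z‖ₑ ^ 2 by ring,
          ENNReal.inv_mul_cancel hV0 hVt, ENNReal.inv_mul_cancel hc0 (by simp), one_mul, one_mul]
    _ ≤ _ := by gcongr

end aux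

variable (α : ℝ) (H : Type*) [NormedAddCommGroup H] [InnerProductSpace ℂ H] [CompleteSpace H]

variable {α H} in
theorem IsAnalytic.memLp {f : Disc → H} (hf : IsAnalytic f)
    (h : Integrable (fun z => ‖f z‖ ^ 2) (areaMeasure α)) : MemLp f 2 (areaMeasure α) :=
  (memLp_two_iff_integrable_sq_norm hf.continuous.aestronglyMeasurable).2 h

/-- The `H`-valued weighted Bergman space `A²_α(H)` as a linear subspace of all functions
on the disc. -/
def bergmanSubmodule : Submodule ℂ (Disc → H) where
  carrier := {f | IsAnalytic f ∧ Integrable (fun z => ‖f z‖ ^ 2) (areaMeasure α)}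
  zero_mem' := ⟨⟨0, fun z => by simp⟩, by simp⟩
  add_mem' := by
    rintro f g ⟨hf, hf2⟩ ⟨hg, hg2⟩
    have h := (hf.memLp hf2).add (hg.memLp hg2)
    refine ⟨?_, (memLp_two_iff_integrable_sq_norm h.1).1 h⟩
    obtain ⟨y, hy⟩ := hf
    obtain ⟨s, hs⟩ := hg
    exact ⟨fun n => y n + s n, fun z => by simpa using (hy z).add (hs z)⟩
  smul_mem' := by
    rintro c f ⟨hf, hf2⟩
    refine ⟨?_, ?_⟩
    · obtain ⟨y, hy⟩ := hf
      refine ⟨fun n => c • y n, fun z => ?_⟩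
      simpa [smul_comm c] using (hy z).const_smul c
    · simpa [norm_smul, mul_pow] using hf2.const_mul (‖c‖ ^ 2)

/-- The `H`-valued weighted Bergman space `A²_α(H)` (a type of its own, so that it carries the
Bergman norm and not the topology of pointwise convergence). -/
def BergmanSpace : Type _ := ↥(bergmanSubmodule α H)

namespace BergmanSpace

instance : AddCommGroup (BergmanSpace α H) :=
  inferInstanceAs (AddCommGroup ↥(bergmanSubmodule α H))

instance : Module ℂ (BergmanSpace α H) :=
  inferInstanceAs (Module ℂ ↥(bergmanSubmodule α H))

variable {α H}

instance : FunLike (BergmanSpace α H) Disc H where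
  coe f := Subtype.val (p := fun f => f ∈ bergmanSubmodule α H) f
  coe_injective := Subtype.val_injective

/-- The element of `A²_α(H)` given by an analytic function of finite norm. -/
def mk (f : Disc → H) (hf : IsAnalytic f)
    (hf2 : Integrable (fun z => ‖f z‖ ^ 2) (areaMeasure α)) : BergmanSpace α H :=
  (⟨f, hf, hf2⟩ : ↥(bergmanSubmodule α H))

theorem mk_apply (f : Disc → H) (hf : IsAnalytic f)
    (hf2 : Integrable (fun z => ‖f z‖ ^ 2) (areaMeasure α)) (z : Disc) :
    mk f hf hf2 z = f z := rfl

theorem isAnalytic (f : BergmanSpace α H) : IsAnalytic f :=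
  (Subtype.property (p := fun f => f ∈ bergmanSubmodule α H) f).1

theorem integrable_norm_sq (f : BergmanSpace α H) :
    Integrable (fun z => ‖f z‖ ^ 2) (areaMeasure α) :=
  (Subtype.property (p := fun f => f ∈ bergmanSubmodule α H) f).2

theorem memLp (f : BergmanSpace α H) : MemLp f 2 (areaMeasure α) :=
  f.isAnalytic.memLp f.integrable_norm_sq

theorem ext {f g : BergmanSpace α H} (h : ∀ z, f z = g z) : f = g := DFunLike.ext _ _ h

theorem zero_apply (z : Disc) : (0 : BergmanSpace α H) z = 0 := rfl

theorem add_apply (f g : BergmanSpace α H) (z : Disc) : (f + g) z = f z + g z := rfl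

theorem sub_apply (f g : BergmanSpace α H) (z : Disc) : (f - g) z = f z - g z := rfl

theorem smul_apply (c : ℂ) (f : BergmanSpace α H) (z : Disc) : (c • f) z = c • f z := rfl

theorem integrable_inner (f g : BergmanSpace α H) :
    Integrable (fun z => inner ℂ (f z) (g z)) (areaMeasure α) := by
  refine (f.integrable_norm_sq.add g.integrable_norm_sq).mono'
    (f.isAnalytic.continuous.inner g.isAnalytic.continuous).aestronglyMeasurable
    (.of_forall fun z => (norm_inner_le_norm _ _).trans ?_)
  simp only [Pi.add_apply]
  nlinarith [sq_nonneg (‖f z‖ - ‖g z‖), sq_nonneg ‖f z‖, sq_nonneg ‖g z‖]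

theorem lintegral_enorm_sq (f : BergmanSpace α H) :
    ∫⁻ z, ‖f z‖ₑ ^ 2 ∂areaMeasure α = ENNReal.ofReal (∫ z, ‖f z‖ ^ 2 ∂areaMeasure α) := by
  rw [ofReal_integral_eq_lintegral_ofReal f.integrable_norm_sq (.of_forall fun z => by positivity)]
  refine lintegral_congr fun z => ?_
  rw [ENNReal.ofReal_pow (norm_nonneg _), ofReal_norm]

theorem integral_inner_self (f : BergmanSpace α H) :
    ∫ z, inner ℂ (f z) (f z) ∂areaMeasure α = ((∫ z, ‖f z‖ ^ 2 ∂areaMeasure α : ℝ) : ℂ) := by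
  rw [← integral_complex_ofReal]
  refine integral_congr_ae (.of_forall fun z => ?_)
  simp [inner_self_eq_norm_sq_to_K]

variable (α H)

/-- The inner product `∫ ⟨f z, g z⟩ dA_α(z)`, conjugate linear in its first argument. -/
abbrev innerCore [hα : Fact (-1 < α)] : InnerProductSpace.Core ℂ (BergmanSpace α H) where
  inner f g := ∫ z, inner ℂ (f z) (g z) ∂areaMeasure α
  conj_inner_symm f g := by
    rw [← integral_conj]
    simp only [inner_conj_symm]
  re_inner_nonneg f := by
    rw [integral_inner_self]
    exact integral_nonneg fun z => by positivity
  add_left f g h := by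
    simp only [add_apply, inner_add_left]
    exact integral_add (integrable_inner f h) (integrable_inner g h)
  smul_left f g c := by
    simp only [smul_apply, inner_smul_left]
    exact integral_const_mul _ _
  definite f h := by
    rw [integral_inner_self, Complex.ofReal_eq_zero] at h
    refine ext fun z => ?_
    obtain ⟨C, hC⟩ := exists_point_bound (X := H) hα.out (norm_nonneg (z : ℂ))
      (mem_ball_zero_iff.1 z.2)
    have := hC f f.isAnalytic z le_rfl
    rw [lintegral_enorm_sq, h] at this
    rw [zero_apply]
    simpa using this

variable [Fact (-1 < α)]

instance : NormedAddCommGroup (BergmanSpace α H) := (innerCore α H).toNormedAddCommGroup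

instance : InnerProductSpace ℂ (BergmanSpace α H) :=
  InnerProductSpace.ofCore (innerCore α H).toCore

variable {α H}

theorem inner_def (f g : BergmanSpace α H) :
    inner ℂ f g = ∫ z, inner ℂ (f z) (g z) ∂areaMeasure α := rfl

theorem norm_sq_eq (f : BergmanSpace α H) : ‖f‖ ^ 2 = ∫ z, ‖f z‖ ^ 2 ∂areaMeasure α := by
  have := inner_self_eq_norm_sq_to_K (𝕜 := ℂ) f
  rw [inner_def, integral_inner_self] at this
  exact (Complex.ofReal_injective (by simpa using this)).symm

theorem enorm_sq_eq (f : BergmanSpace α H) :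
    ‖f‖ₑ ^ 2 = ∫⁻ z, ‖f z‖ₑ ^ 2 ∂areaMeasure α := by
  rw [lintegral_enorm_sq, ← norm_sq_eq, ENNReal.ofReal_pow (norm_nonneg _), ofReal_norm]

theorem exists_norm_apply_le {r : ℝ} (hr0 : 0 ≤ r) (hr : r < 1) :
    ∃ C : ℝ, 0 ≤ C ∧ ∀ (f : BergmanSpace α H) (z : Disc), ‖(z : ℂ)‖ ≤ r → ‖f z‖ ≤ C * ‖f‖ := by
  obtain ⟨C, hC⟩ := exists_point_bound (X := H) (Fact.out : -1 < α) hr0 hr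
  refine ⟨√(C : ℝ), by positivity, fun f z hz => ?_⟩
  have h := hC f f.isAnalytic z hz
  rw [← enorm_sq_eq] at h
  have h2 : ‖f z‖ ^ 2 ≤ C * ‖f‖ ^ 2 := by
    have h3 := ENNReal.toReal_mono (by finiteness) h
    simpa using h3
  refine abs_le_of_sq_le_sq' ?_ (by positivity) |>.2
  calc ‖f z‖ ^ 2 ≤ C * ‖f‖ ^ 2 := h2
    _ = (√(C : ℝ) * ‖f‖) ^ 2 := by rw [mul_pow, Real.sq_sqrt C.coe_nonneg]

/-- `A²_α(H)` is a Hilbert space. -/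
instance : CompleteSpace (BergmanSpace α H) := by
  refine Metric.complete_of_cauchySeq_tendsto fun u hu => ?_
  have hev : ∀ z : Disc, CauchySeq fun n => u n z := by
    intro z
    obtain ⟨C, hC0, hC⟩ := exists_norm_apply_le (α := α) (H := H) (norm_nonneg (z : ℂ))
      (mem_ball_zero_iff.1 z.2)
    have hL : LipschitzWith ⟨C, hC0⟩ fun f : BergmanSpace α H => f z :=
      LipschitzWith.of_dist_le_mul fun f g => by
        rw [dist_eq_norm, dist_eq_norm]
        exact hC (f - g) z le_rfl
    exact hL.uniformContinuous.comp_cauchySeq hu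
  choose f hf using fun z => cauchySeq_tendsto_of_complete (hev z)
  have hdiff : ∀ N : ℕ, ∀ ε : ℝ, (∀ n ≥ N, ∀ m ≥ N, ‖u n - u m‖ ≤ ε) → ∀ n ≥ N,
      ∫⁻ z, ‖u n z - f z‖ₑ ^ 2 ∂areaMeasure α ≤ ENNReal.ofReal ε ^ 2 := by
    intro N ε hN n hn
    have hlim : ∀ z, Tendsto (fun m => ‖u n z - u m z‖ₑ ^ 2) atTop (𝓝 (‖u n z - f z‖ₑ ^ 2)) :=
      fun z => ((ENNReal.continuous_pow 2).tendsto _).comp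
        (tendsto_const_nhds.sub (hf z)).enorm
    calc ∫⁻ z, ‖u n z - f z‖ₑ ^ 2 ∂areaMeasure α
        = ∫⁻ z, liminf (fun m => ‖u n z - u m z‖ₑ ^ 2) atTop ∂areaMeasure α :=
          lintegral_congr fun z => (hlim z).liminf_eq.symm
      _ ≤ liminf (fun m => ∫⁻ z, ‖u n z - u m z‖ₑ ^ 2 ∂areaMeasure α) atTop := by
          refine lintegral_liminf_le' fun m => ?_
          exact ((u n - u m).isAnalytic.continuous.enorm.measurable.pow_const 2).aemeasurable
      _ ≤ ENNReal.ofReal ε ^ 2 := by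
          refine liminf_le_of_le (by isBoundedDefault) fun b hb => ?_
          obtain ⟨m, hm, hmN⟩ := (hb.and (eventually_ge_atTop N)).exists
          refine hm.trans ?_
          have := enorm_sq_eq (u n - u m)
          simp only [sub_apply] at this
          rw [← this, ← ofReal_norm]
          gcongr
          exact hN n hn m hmN
  have han : IsAnalytic f := by
    refine isAnalytic_of_differentiableOn (F := extend f) ?_ (extend_coe f)
    have hloc : TendstoLocallyUniformlyOn (fun n => extend (u n)) (extend f) atTop
        (Metric.ball (0 : ℂ) 1) := by
      rw [tendstoLocallyUniformlyOn_iff_forall_isCompact Metric.isOpen_ball]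
      intro K hK hKc
      obtain ⟨r, hr0, hr, hKr⟩ : ∃ r : ℝ, 0 ≤ r ∧ r < 1 ∧ ∀ w ∈ K, ‖w‖ ≤ r := by
        rcases K.eq_empty_or_nonempty with rfl | hne
        · exact ⟨0, le_rfl, one_pos, by simp⟩
        · obtain ⟨w, hw, hmax⟩ := hKc.exists_isMaxOn hne continuous_norm.continuousOn
          exact ⟨‖w‖, norm_nonneg _, by simpa using hK hw, fun v hv => hmax hv⟩
      obtain ⟨C, hC0, hC⟩ := exists_norm_apply_le (α := α) (H := H) hr0 hr
      have hU : UniformCauchySeqOn (fun n => extend (u n)) atTop K := by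
        rw [Metric.uniformCauchySeqOn_iff]
        intro ε hε
        obtain ⟨N, hN⟩ := Metric.cauchySeq_iff.1 hu (ε / (C + 1)) (by positivity)
        refine ⟨N, fun m hm n hn w hw => ?_⟩
        have h1 := hN m hm n hn
        have h2 := hC (u m - u n) ⟨w, hK hw⟩ (hKr w hw)
        rw [show extend (u m) w = u m ⟨w, hK hw⟩ from extend_coe (u m) ⟨w, hK hw⟩,
          show extend (u n) w = u n ⟨w, hK hw⟩ from extend_coe (u n) ⟨w, hK hw⟩, dist_eq_norm]
        rw [dist_eq_norm, lt_div_iff₀ (by positivity)] at h1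
        rw [sub_apply] at h2
        nlinarith [norm_nonneg (u m - u n)]
      refine hU.tendstoUniformlyOn_of_tendsto fun w hw => ?_
      have := hf ⟨w, hK hw⟩
      simpa only [← extend_coe] using this
    exact hloc.differentiableOn (.of_forall fun n => (u n).isAnalytic.differentiableOn)
      Metric.isOpen_ball
  have hcont := han.continuous
  have hCauchy : ∀ ε > 0, ∃ N, ∀ n ≥ N, ∀ m ≥ N, ‖u n - u m‖ ≤ ε := by
    intro ε hε
    obtain ⟨N, hN⟩ := Metric.cauchySeq_iff.1 hu ε hε
    exact ⟨N, fun n hn m hm => by rw [← dist_eq_norm]; exact (hN n hn m hm).le⟩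
  have hint : Integrable (fun z => ‖f z‖ ^ 2) (areaMeasure α) := by
    obtain ⟨N, hN⟩ := hCauchy 1 one_pos
    have h1 := hdiff N 1 hN N le_rfl
    have hc : Continuous fun z => u N z - f z := (u N).isAnalytic.continuous.sub hcont
    have h2 : MemLp (fun z => u N z - f z) 2 (areaMeasure α) := by
      refine (memLp_two_iff_integrable_sq_norm hc.aestronglyMeasurable).2
        ⟨(hc.norm.pow 2).aestronglyMeasurable, ?_⟩
      refine lt_of_le_of_lt (le_of_eq ?_) (h1.trans_lt (by simp))
      refine lintegral_congr fun z => ?_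
      simp [enorm_pow]
    have h3 := (u N).memLp.sub h2
    refine (memLp_two_iff_integrable_sq_norm hcont.aestronglyMeasurable).1 (h3.ae_eq ?_)
    exact .of_forall fun z => by simp
  refine ⟨mk f han hint, Metric.tendsto_atTop'.2 fun ε hε => ?_⟩
  obtain ⟨N, hN⟩ := hCauchy (ε / 2) (half_pos hε)
  refine ⟨N, fun n hn => ?_⟩
  have h1 := hdiff N _ hN n hn.le
  set g : BergmanSpace α H := mk f han hint
  have h2 : ‖u n - g‖ₑ ^ 2 ≤ ENNReal.ofReal (ε / 2) ^ 2 := by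
    rw [enorm_sq_eq]; exact h1
  have h3 : ‖u n - g‖ ≤ ε / 2 := by
    have h4 : ‖u n - g‖ₑ ≤ ENNReal.ofReal (ε / 2) :=
      (ENNReal.pow_le_pow_left_iff two_ne_zero).1 h2
    rw [← ofReal_norm] at h4
    exact (ENNReal.ofReal_le_ofReal_iff (half_pos hε).le).1 h4
  rw [dist_eq_norm]
  linarith

end BergmanSpace

section littlewood

open Real (circleAverage)

variable {X : Type*} [NormedAddCommGroup X] [NormedSpace ℂ X]

/-- `‖F‖²` is dominated by its Poisson integral. -/
theorem norm_sq_le_poisson [CompleteSpace X] {F : ℂ → X} {R : ℝ} (hR : 0 < R)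
    (hF : DiffContOnCl ℂ F (Metric.ball 0 R)) {w : ℂ} (hw : w ∈ Metric.ball 0 R) :
    ‖F w‖ ^ 2 ≤ circleAverage ((Complex.re ∘ herglotzRieszKernel 0 w) • fun ζ => ‖F ζ‖ ^ 2) 0 R := by
  have habs : |R| = R := abs_of_pos hR
  have hk : ContinuousOn (Complex.re ∘ herglotzRieszKernel 0 w) (Metric.sphere 0 |R|) :=
    Complex.continuous_re.comp_continuousOn (continuousOn_herglotzRieszKernel_sphere hw)
  have hFc : ContinuousOn F (Metric.sphere 0 |R|) := by
    rw [habs]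
    exact (hF.continuousOn_ball).mono Metric.sphere_subset_closedBall
  have hk0 : ∀ ζ ∈ Metric.sphere (0 : ℂ) |R|, 0 ≤ (Complex.re ∘ herglotzRieszKernel 0 w) ζ := by
    intro ζ hζ
    rw [habs] at hζ
    refine le_trans ?_ (le_re_herglotzRieszKernel hζ hw)
    have : ‖w - 0‖ < R := mem_ball_iff_norm.1 hw
    have := norm_nonneg (w - 0)
    exact div_nonneg (by linarith) (by linarith)
  have hone : circleAverage (Complex.re ∘ herglotzRieszKernel 0 w) 0 R = 1 := by
    have h1 := (diffContOnCl_const (c := (1 : ℂ)) (s := Metric.ball (0 : ℂ) R)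
      (𝕜 := ℂ)).circleAverage_re_herglotzRieszKernel_smul hw
    have hci : CircleIntegrable ((Complex.re ∘ herglotzRieszKernel 0 w) • fun _ => (1 : ℂ)) 0 R :=
      ContinuousOn.circleIntegrable' (hk.smul continuousOn_const)
    have h2 := Complex.reCLM.circleAverage_comp_comm hci
    rw [h1] at h2
    simp only [Complex.reCLM_apply, Complex.one_re] at h2
    rw [← h2]
    congr 1
    funext ζ
    simp
  have hmain := hF.circleAverage_re_herglotzRieszKernel_smul hw
  set k := Complex.re ∘ herglotzRieszKernel 0 w with hkd
  set a := ‖F w‖ with ha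
  have hi1 : CircleIntegrable (k • fun ζ => ‖F ζ‖) 0 R :=
    ContinuousOn.circleIntegrable' (hk.smul hFc.norm)
  have hi2 : CircleIntegrable (k • fun ζ => ‖F ζ‖ ^ 2) 0 R :=
    ContinuousOn.circleIntegrable' (hk.smul (hFc.norm.pow 2))
  have hi3 : CircleIntegrable k 0 R := ContinuousOn.circleIntegrable' hk
  have h1 : a ≤ circleAverage (k • fun ζ => ‖F ζ‖) 0 R := by
    rw [ha, ← hmain, Real.circleAverage_def, Real.circleAverage_def, norm_smul,
      Real.norm_of_nonneg (by positivity), smul_eq_mul]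
    refine mul_le_mul_of_nonneg_left ?_ (by positivity)
    refine (intervalIntegral.norm_integral_le_integral_norm (by positivity)).trans (le_of_eq ?_)
    refine intervalIntegral.integral_congr fun θ _ => ?_
    simp only [Pi.smul_apply', norm_smul, smul_eq_mul]
    rw [Real.norm_of_nonneg (hk0 _ (circleMap_mem_sphere' 0 R θ))]
  have h2 : circleAverage ((2 * a) • (k • fun ζ => ‖F ζ‖)) 0 R ≤
      circleAverage ((a ^ 2) • k + k • fun ζ => ‖F ζ‖ ^ 2) 0 R := by
    refine Real.circleAverage_mono (hi1.const_smul) (hi3.const_smul.add hi2) fun ζ hζ => ?_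
    have := hk0 ζ hζ
    simp only [Pi.smul_apply, Pi.mul_apply, Pi.add_apply, smul_eq_mul]
    nlinarith [mul_nonneg this (sq_nonneg (a - ‖F ζ‖))]
  rw [Real.circleAverage_smul, Real.circleAverage_add hi3.const_smul hi2, Real.circleAverage_smul,
    hone] at h2
  have ha0 : 0 ≤ a := norm_nonneg _
  have h3 := mul_le_mul_of_nonneg_left h1 ha0
  simp only [smul_eq_mul] at h2 h3 ⊢
  linarith

/-- A form of Littlewood's subordination principle. -/
theorem circleAverage_comp_le [CompleteSpace X] {F : ℂ → X} {R : ℝ} (hR : 0 < R)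
    (hF : DiffContOnCl ℂ F (Metric.ball 0 R)) {Φ : ℂ → ℂ} {ρ : ℝ} (hρ : 0 < ρ)
    (hΦ : DifferentiableOn ℂ Φ (Metric.closedBall 0 ρ))
    (hmaps : ∀ z ∈ Metric.closedBall (0 : ℂ) ρ, Φ z ∈ Metric.ball (0 : ℂ) R) :
    circleAverage (fun z => ‖F (Φ z)‖ ^ 2) 0 ρ ≤
      (R + ‖Φ 0‖) / (R - ‖Φ 0‖) * circleAverage (fun z => ‖F z‖ ^ 2) 0 R := by
  have habs : |R| = R := abs_of_pos hR
  have hFc : ContinuousOn F (Metric.closedBall 0 R) := hF.continuousOn_ball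
  have hg : CircleIntegrable (fun ζ => ‖F ζ‖ ^ 2) 0 R := by
    refine ContinuousOn.circleIntegrable' ?_
    rw [habs]
    exact ((hFc.norm.pow 2).mono Metric.sphere_subset_closedBall)
  set G : ℂ → ℂ := fun w =>
    circleAverage (fun ζ => herglotzRieszKernel 0 w ζ • ((‖F ζ‖ ^ 2 : ℝ) : ℂ)) 0 R with hG
  have hGd : DifferentiableOn ℂ G (Metric.ball 0 R) := by
    refine differentiableOn_circleAverage_herglotzRieszKernel_smul ?_
    refine ContinuousOn.circleIntegrable' ?_
    rw [habs]
    exact Complex.continuous_ofReal.comp_continuousOn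
      ((hFc.norm.pow 2).mono Metric.sphere_subset_closedBall)
  have hGre : ∀ w ∈ Metric.ball (0 : ℂ) R, (G w).re =
      circleAverage ((Complex.re ∘ herglotzRieszKernel 0 w) • fun ζ => ‖F ζ‖ ^ 2) 0 R :=
    fun w hw => re_circleAverage_herglotzRieszKernel_smul hg hw
  have hcomp : DifferentiableOn ℂ (fun z => G (Φ z)) (Metric.closedBall 0 ρ) :=
    hGd.comp hΦ hmaps
  have hav : circleAverage (fun z => (G (Φ z)).re) 0 ρ = (G (Φ 0)).re := by
    have hd : DiffContOnCl ℂ (fun z => G (Φ z)) (Metric.ball 0 |ρ|) := by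
      refine DifferentiableOn.diffContOnCl ?_
      rw [abs_of_pos hρ, closure_ball _ hρ.ne']
      exact hcomp
    have hci : CircleIntegrable (fun z => G (Φ z)) 0 ρ := by
      refine ContinuousOn.circleIntegrable' (hcomp.continuousOn.mono ?_)
      rw [abs_of_pos hρ]
      exact Metric.sphere_subset_closedBall
    have h2 := Complex.reCLM.circleAverage_comp_comm hci
    rw [hd.circleAverage] at h2
    exact h2
  have hsphere : Metric.sphere (0 : ℂ) |ρ| ⊆ Metric.closedBall 0 ρ := by
    rw [abs_of_pos hρ]
    exact Metric.sphere_subset_closedBall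
  have h0 : Φ 0 ∈ Metric.ball (0 : ℂ) R := hmaps 0 (by simp [hρ.le])
  calc circleAverage (fun z => ‖F (Φ z)‖ ^ 2) 0 ρ
      ≤ circleAverage (fun z => (G (Φ z)).re) 0 ρ := by
        refine Real.circleAverage_mono ?_ ?_ fun z hz => ?_
        · refine ContinuousOn.circleIntegrable' (ContinuousOn.mono ?_ hsphere)
          refine (ContinuousOn.norm ?_).pow 2
          exact hFc.comp hΦ.continuousOn fun z hz => Metric.ball_subset_closedBall (hmaps z hz)
        · refine ContinuousOn.circleIntegrable' (ContinuousOn.mono ?_ hsphere)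
          exact Complex.continuous_re.comp_continuousOn hcomp.continuousOn
        · have hz' := hmaps z (hsphere hz)
          rw [hGre _ hz']
          exact norm_sq_le_poisson hR hF hz'
    _ = (G (Φ 0)).re := hav
    _ ≤ circleAverage (((R + ‖Φ 0‖) / (R - ‖Φ 0‖)) • fun ζ => ‖F ζ‖ ^ 2) 0 R := by
        rw [hGre _ h0]
        refine Real.circleAverage_mono ?_ hg.const_smul fun ζ hζ => ?_
        · refine ContinuousOn.circleIntegrable' (ContinuousOn.smul ?_ ?_)
          · exact Complex.continuous_re.comp_continuousOn
              (continuousOn_herglotzRieszKernel_sphere h0)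
          · rw [habs]
            exact (hFc.norm.pow 2).mono Metric.sphere_subset_closedBall
        · rw [habs] at hζ
          have := re_herglotzRieszKernel_le hζ h0
          rw [sub_zero (Φ 0)] at this
          simp only [Pi.smul_apply, Pi.smul_apply', smul_eq_mul, Function.comp_apply,
            herglotzRieszKernel_def, sub_zero] at this ⊢
          exact mul_le_mul_of_nonneg_right this (by positivity)
    _ = _ := by rw [Real.circleAverage_smul, smul_eq_mul]

/-- A consequence of the Schwarz lemma. -/
theorem one_sub_norm_ge {Φ : ℂ → ℂ} (hΦ : DifferentiableOn ℂ Φ (Metric.ball 0 1))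
    (hmaps : ∀ z ∈ Metric.ball (0 : ℂ) 1, ‖Φ z‖ < 1) {z : ℂ} (hz : ‖z‖ < 1) :
    (1 - ‖Φ 0‖) / 4 * (1 - ‖z‖) ≤ 1 - ‖Φ z‖ := by
  have hz' : z ∈ Metric.ball (0 : ℂ) 1 := by simpa using hz
  have h0 : ‖Φ 0‖ < 1 := hmaps 0 (by simp)
  set a := Φ 0 with ha
  have hne : ∀ w ∈ Metric.ball (0 : ℂ) 1, 1 - (starRingEnd ℂ) a * Φ w ≠ 0 := by
    intro w hw h
    have h1 : ‖(starRingEnd ℂ) a * Φ w‖ = 1 := by rw [← sub_eq_zero.1 h, norm_one]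
    rw [norm_mul, RCLike.norm_conj] at h1
    nlinarith [hmaps w hw, norm_nonneg a, norm_nonneg (Φ w)]
  have hid : ∀ b : ℂ, ‖1 - (starRingEnd ℂ) a * b‖ ^ 2 - ‖b - a‖ ^ 2 =
      (1 - ‖a‖ ^ 2) * (1 - ‖b‖ ^ 2) := by
    intro b
    simp only [← Complex.normSq_eq_norm_sq, Complex.normSq_apply]
    simp
    ring
  set ψ : ℂ → ℂ := fun w => (Φ w - a) / (1 - (starRingEnd ℂ) a * Φ w) with hψ
  have hψd : DifferentiableOn ℂ ψ (Metric.ball 0 1) :=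
    (hΦ.sub_const a).div ((hΦ.const_mul _).const_sub 1) hne
  have hle : ∀ w ∈ Metric.ball (0 : ℂ) 1, ‖ψ w‖ ≤ 1 := by
    intro w hw
    rw [hψ, norm_div, div_le_one (norm_pos_iff.2 (hne w hw))]
    refine abs_le_of_sq_le_sq' ?_ (norm_nonneg _) |>.2
    have := hid (Φ w)
    have h1 : 0 ≤ (1 - ‖a‖ ^ 2) * (1 - ‖Φ w‖ ^ 2) :=
      mul_nonneg (by nlinarith [norm_nonneg a]) (by nlinarith [norm_nonneg (Φ w), hmaps w hw])
    linarith
  have hS : ‖ψ z‖ ≤ ‖z‖ := by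
    refine Complex.norm_le_norm_of_mapsTo_ball hψd (fun w hw => ?_) ?_ hz
    · simpa using hle w hw
    · simp [hψ, ha]
  have hD : 0 < ‖1 - (starRingEnd ℂ) a * Φ z‖ := norm_pos_iff.2 (hne z hz')
  rw [hψ, norm_div, div_le_iff₀ hD] at hS
  have hlow : 1 - ‖a‖ ≤ ‖1 - (starRingEnd ℂ) a * Φ z‖ := by
    have := norm_sub_norm_le (1 : ℂ) ((starRingEnd ℂ) a * Φ z)
    rw [norm_one, norm_mul, RCLike.norm_conj] at this
    nlinarith [hmaps z hz', norm_nonneg a]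
  have hidz := hid (Φ z)
  have hb := hmaps z hz'
  have hN := norm_nonneg (Φ z - a)
  generalize ‖1 - (starRingEnd ℂ) a * Φ z‖ = D at *
  generalize ‖Φ z - a‖ = N at *
  have hb0 := norm_nonneg (Φ z)
  have ha0 := norm_nonneg a
  have hz0 := norm_nonneg z
  generalize ‖Φ z‖ = b at *
  generalize ‖a‖ = c at *
  generalize ‖z‖ = t at *
  have hN0 : N ^ 2 ≤ (t * D) ^ 2 := by gcongr
  have h3 : (1 - c) ^ 2 * (1 - t ^ 2) ≤ (1 - c ^ 2) * (1 - b ^ 2) := by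
    rw [← hidz]
    have : (1 - c) ^ 2 ≤ D ^ 2 := by nlinarith
    nlinarith [mul_le_mul_of_nonneg_right this (show 0 ≤ 1 - t ^ 2 by nlinarith)]
  have h4 : (1 - c) * (1 - t ^ 2) ≤ (1 + c) * (1 - b ^ 2) := by
    have : (1 - c) * ((1 - c) * (1 - t ^ 2)) ≤ (1 - c) * ((1 + c) * (1 - b ^ 2)) := by
      nlinarith
    exact le_of_mul_le_mul_left this (by linarith)
  have h5 : (1 - c) * (1 - t) ≤ (1 - c) * (1 - t ^ 2) :=
    mul_le_mul_of_nonneg_left (by nlinarith) (by linarith)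
  have h6 : (1 + c) * (1 - b ^ 2) ≤ 2 * (2 * (1 - b)) :=
    mul_le_mul (by linarith) (by nlinarith) (by nlinarith) (by norm_num)
  linarith


theorem lintegral_eq_polar [CompleteSpace X] {α : ℝ} (hα : -1 < α) {G : ℂ → X}
    (hG : ContinuousOn G (Metric.ball 0 1)) :
    ∫⁻ z : Disc, ‖G z‖ₑ ^ 2 ∂areaMeasure α = ∫⁻ ρ in Set.Ioo (0 : ℝ) 1,
      ENNReal.ofReal (2 * (α + 1) * (ρ * (1 - ρ ^ 2) ^ α *
        circleAverage (fun z => ‖G z‖ ^ 2) 0 ρ)) := by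
  classical
  set φ : ℂ → ℝ≥0∞ := (Metric.ball (0 : ℂ) 1).indicator
    fun w => ENNReal.ofReal (weight α w) * ‖G w‖ₑ ^ 2 with hφ
  have hmφ : Measurable φ := by
    have hw : Measurable fun w : ℂ => ENNReal.ofReal (weight α w) := by
      unfold weight; fun_prop
    have h1 : Measurable ((Metric.ball (0 : ℂ) 1).piecewise (fun w => ‖G w‖ₑ) 0) :=
      ContinuousOn.measurable_piecewise hG.enorm continuousOn_const
        Metric.isOpen_ball.measurableSet
    have h2 : φ = (Metric.ball (0 : ℂ) 1).indicator fun w => ENNReal.ofReal (weight α w) *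
        ((Metric.ball (0 : ℂ) 1).piecewise (fun w => ‖G w‖ₑ) 0 w) ^ 2 := by
      refine Set.indicator_congr fun w hw => ?_
      rw [Set.piecewise_eq_of_mem _ _ _ hw]
    rw [h2]
    exact (hw.mul (h1.pow_const 2)).indicator Metric.isOpen_ball.measurableSet
  have hpol : ∀ p : ℝ × ℝ, Complex.polarCoord.symm p = circleMap 0 p.1 p.2 := by
    intro p
    rw [Complex.polarCoord_symm_apply, circleMap, zero_add, Complex.exp_mul_I]
    push_cast
    rfl
  rw [lintegral_areaMeasure α fun w => ‖G w‖ₑ ^ 2,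
    ← lintegral_indicator Metric.isOpen_ball.measurableSet,
    ← Complex.lintegral_comp_polarCoord_symm φ, polarCoord_target,
    Measure.volume_eq_prod, ← Measure.prod_restrict, lintegral_prod]
  swap
  · simp only [hpol, smul_eq_mul]
    refine Measurable.aemeasurable (Measurable.mul (by fun_prop) (hmφ.comp ?_))
    exact (Real.circleMap.continuous (c := 0)).measurable
  rw [← lintegral_indicator measurableSet_Ioi, ← lintegral_indicator measurableSet_Ioo]
  refine lintegral_congr fun ρ => ?_
  by_cases hρ : ρ ∈ Set.Ioo (0 : ℝ) 1
  · rw [Set.indicator_of_mem hρ, Set.indicator_of_mem (show ρ ∈ Set.Ioi (0 : ℝ) from hρ.1)]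
    have hin : ∀ θ : ℝ, circleMap 0 ρ θ ∈ Metric.ball (0 : ℂ) 1 := fun θ => by
      simp [abs_of_pos hρ.1, hρ.2]
    have hq : Continuous fun θ : ℝ => ‖G (circleMap 0 ρ θ)‖ ^ 2 :=
      (hG.comp_continuous (continuous_circleMap 0 ρ) hin).norm.pow 2
    have hw : ∀ θ : ℝ, weight α (circleMap 0 ρ θ) = (α + 1) / Real.pi * (1 - ρ ^ 2) ^ α := by
      intro θ
      simp [weight]
    have hcong : ∀ θ : ℝ, ENNReal.ofReal ρ • φ (Complex.polarCoord.symm (ρ, θ)) =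
        ENNReal.ofReal (ρ * ((α + 1) / Real.pi * (1 - ρ ^ 2) ^ α)) *
          ENNReal.ofReal (‖G (circleMap 0 ρ θ)‖ ^ 2) := by
      intro θ
      rw [hpol, hφ, Set.indicator_of_mem (hin θ), hw, smul_eq_mul, ENNReal.ofReal_mul hρ.1.le,
        ENNReal.ofReal_pow (norm_nonneg _), ofReal_norm, mul_assoc]
    have hint : ∫ θ in Set.Ioo (-Real.pi) Real.pi, ‖G (circleMap 0 ρ θ)‖ ^ 2 =
        2 * Real.pi * circleAverage (fun z => ‖G z‖ ^ 2) 0 ρ := by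
      rw [Real.circleAverage_eq_integral_add (-Real.pi),
        intervalIntegral.integral_comp_add_right
          (fun θ => ‖G (circleMap 0 ρ θ)‖ ^ 2), smul_eq_mul,
        show (0 : ℝ) + -Real.pi = -Real.pi by ring,
        show 2 * Real.pi + -Real.pi = Real.pi by ring,
        intervalIntegral.integral_of_le (by linarith [Real.pi_pos]), integral_Ioc_eq_integral_Ioo]
      field_simp
    have hwpos : 0 ≤ ρ * ((α + 1) / Real.pi * (1 - ρ ^ 2) ^ α) := by
      have : 0 ≤ 1 - ρ ^ 2 := by nlinarith [hρ.1, hρ.2]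
      have := Real.rpow_nonneg this α
      have h2 : 0 ≤ α + 1 := by linarith
      have := hρ.1
      positivity
    simp only [hcong]
    rw [lintegral_const_mul _ hq.measurable.ennreal_ofReal,
      ← ofReal_integral_eq_lintegral_ofReal
        ((hq.integrableOn_Icc (a := -Real.pi) (b := Real.pi)).mono_set Set.Ioo_subset_Icc_self)
        (.of_forall fun θ => by positivity), hint, ← ENNReal.ofReal_mul hwpos]
    congr 1
    field_simp
  · rw [Set.indicator_of_notMem hρ]
    by_cases hρ0 : ρ ∈ Set.Ioi (0 : ℝ)
    · rw [Set.indicator_of_mem hρ0]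
      have hout : ∀ θ : ℝ, circleMap 0 ρ θ ∉ Metric.ball (0 : ℂ) 1 := fun θ h => by
        have h1 : |ρ| < 1 := by simpa using h
        exact hρ ⟨hρ0, (le_abs_self ρ).trans_lt h1⟩
      simp only [hpol, hφ, Set.indicator_of_notMem (hout _), smul_zero, lintegral_zero]
    · rw [Set.indicator_of_notMem hρ0]

theorem lintegral_comp_affine_le {k : ℝ} (hk : 0 < k) (hk1 : k ≤ 1) (h : ℝ → ℝ≥0∞) :
    ∫⁻ ρ in Set.Ioo (0 : ℝ) 1, h (1 - k * (1 - ρ)) ≤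
      ENNReal.ofReal k⁻¹ * ∫⁻ ρ in Set.Ioo (0 : ℝ) 1, h ρ := by
  set H : ℝ → ℝ≥0∞ := (Set.Ioo (0 : ℝ) 1).indicator h with hH
  have h1 : ∫⁻ ρ, H (k * ρ + (1 - k)) = ENNReal.ofReal k⁻¹ * ∫⁻ ρ, H ρ := by
    have e := (Homeomorph.mulLeft₀ k hk.ne').measurableEmbedding.lintegral_map
      (μ := volume) fun x => H (x + (1 - k))
    have e2 : Measure.map (Homeomorph.mulLeft₀ k hk.ne') volume =
        ENNReal.ofReal k⁻¹ • (volume : Measure ℝ) := by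
      have := Real.map_volume_mul_left hk.ne'
      rwa [abs_of_pos (inv_pos.2 hk)] at this
    rw [e2, lintegral_smul_measure, lintegral_add_right_eq_self H (1 - k)] at e
    exact e.symm
  calc ∫⁻ ρ in Set.Ioo (0 : ℝ) 1, h (1 - k * (1 - ρ))
      ≤ ∫⁻ ρ, H (k * ρ + (1 - k)) := by
        rw [← lintegral_indicator measurableSet_Ioo]
        refine lintegral_mono fun ρ => ?_
        by_cases hρ : ρ ∈ Set.Ioo (0 : ℝ) 1
        · rw [Set.indicator_of_mem hρ, hH, Set.indicator_of_mem]
          · exact le_of_eq (by congr 1; ring)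
          · constructor <;> nlinarith [hρ.1, hρ.2]
        · rw [Set.indicator_of_notMem hρ]; exact bot_le
    _ = _ := by rw [h1, hH, lintegral_indicator measurableSet_Ioo]

/-- Composition with an analytic self-map of the disc is bounded for the Bergman norm. -/
theorem exists_comp_bound {α : ℝ} (hα : -1 < α) {Φ : ℂ → ℂ}
    (hΦ : DifferentiableOn ℂ Φ (Metric.ball 0 1))
    (hmaps : ∀ z ∈ Metric.ball (0 : ℂ) 1, ‖Φ z‖ < 1) :
    ∃ C : ℝ≥0, ∀ {X : Type*} [NormedAddCommGroup X] [NormedSpace ℂ X] [CompleteSpace X]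
      (F : ℂ → X), DifferentiableOn ℂ F (Metric.ball 0 1) →
      ∫⁻ z : Disc, ‖F (Φ z)‖ₑ ^ 2 ∂areaMeasure α ≤ C * ∫⁻ z : Disc, ‖F z‖ₑ ^ 2 ∂areaMeasure α := by
  set c := ‖Φ 0‖ with hc
  have hc0 : 0 ≤ c := norm_nonneg _
  have hc1 : c < 1 := hmaps 0 (by simp)
  set k : ℝ := (1 - c) / 8 with hk
  have hk0 : 0 < k := by rw [hk]; linarith
  have hk1 : k ≤ 1 := by rw [hk]; linarith
  set D : ℝ := (1 / (2 * k)) ^ α + (1 / k) ^ α with hD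
  have hD0 : 0 ≤ D := by positivity
  set E : ℝ := 4 / (1 - c) with hE
  have hE0 : 0 ≤ E := div_nonneg (by norm_num) (by linarith)
  refine ⟨(E * D * k⁻¹).toNNReal, fun F hF => ?_⟩
  have hmt : Set.MapsTo Φ (Metric.ball 0 1) (Metric.ball 0 1) := fun z hz => by
    simpa using hmaps z hz
  rw [lintegral_eq_polar hα (G := fun z => F (Φ z)) (hF.comp hΦ hmt).continuousOn,
    lintegral_eq_polar hα hF.continuousOn]
  set J : ℝ → ℝ := circleAverage (fun z => ‖F z‖ ^ 2) 0 with hJ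
  have hJ0 : ∀ R, 0 ≤ J R := fun R =>
    Real.circleAverage_nonneg_of_nonneg fun z _ => by positivity
  have hpt : ∀ ρ ∈ Set.Ioo (0 : ℝ) 1,
      2 * (α + 1) * (ρ * (1 - ρ ^ 2) ^ α * circleAverage (fun z => ‖F (Φ z)‖ ^ 2) 0 ρ) ≤
      E * D * (2 * (α + 1) * ((1 - k * (1 - ρ)) * (1 - (1 - k * (1 - ρ)) ^ 2) ^ α *
        J (1 - k * (1 - ρ)))) := by
    intro ρ hρ
    obtain ⟨hρ0, hρ1⟩ := hρ
    set R := 1 - k * (1 - ρ) with hR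
    have hkρ : 0 < k * (1 - ρ) := mul_pos hk0 (by linarith)
    have hkρ' : k * (1 - ρ) ≤ k := by nlinarith
    have hR1 : R < 1 := by rw [hR]; linarith
    have hRρ : ρ ≤ R := by rw [hR]; nlinarith
    have hR0 : 0 < R := hρ0.trans_le hRρ
    have hRc : (1 - c) / 2 ≤ R - c := by rw [hR]; linarith
    have hcb : Metric.closedBall (0 : ℂ) ρ ⊆ Metric.ball 0 1 :=
      Metric.closedBall_subset_ball hρ1
    have hL := circleAverage_comp_le (F := F) (R := R) hR0
      (DifferentiableOn.diffContOnCl (by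
        rw [closure_ball _ hR0.ne']
        exact hF.mono (Metric.closedBall_subset_ball hR1))) hρ0 (hΦ.mono hcb) (fun z hz => by
        have h1 := one_sub_norm_ge hΦ hmaps (z := z) (by simpa using hcb hz)
        rw [mem_closedBall_zero_iff] at hz
        rw [mem_ball_zero_iff, hR]
        have h2 : (1 - c) / 4 * (1 - ρ) ≤ (1 - c) / 4 * (1 - ‖z‖) :=
          mul_le_mul_of_nonneg_left (by linarith) (by linarith)
        have h3 : (1 - c) / 4 * (1 - ρ) = 2 * (k * (1 - ρ)) := by rw [hk]; ring
        rw [← hc] at h1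
        linarith)
    have hfrac : (R + c) / (R - c) ≤ E := by
      rw [hE, div_le_div_iff₀ (by linarith) (by linarith)]
      nlinarith
    have hI : circleAverage (fun z => ‖F (Φ z)‖ ^ 2) 0 ρ ≤ E * J R :=
      hL.trans (mul_le_mul_of_nonneg_right hfrac (hJ0 R))
    have hRsq : 1 - R ^ 2 = k * (1 - ρ) * (1 + R) := by rw [hR]; ring
    have hS0 : 0 < 1 - R ^ 2 := by rw [hRsq]; positivity
    have hρsq : 0 < 1 - ρ ^ 2 := by nlinarith
    have hq : (1 - ρ ^ 2) ^ α ≤ D * (1 - R ^ 2) ^ α := by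
      rw [← div_le_iff₀ (by positivity), ← Real.div_rpow hρsq.le hS0.le]
      set x := (1 - ρ ^ 2) / (1 - R ^ 2) with hx
      have hxl : 1 / (2 * k) ≤ x := by
        rw [hx, hRsq, div_le_div_iff₀ (by positivity) (by positivity)]
        nlinarith
      have hxu : x ≤ 1 / k := by
        rw [hx, hRsq, div_le_div_iff₀ (by positivity) (by positivity)]
        nlinarith
      have hx0 : 0 < x := lt_of_lt_of_le (by positivity) hxl
      rcases le_total 0 α with h | h
      · have := Real.rpow_le_rpow hx0.le hxu h
        have h' : 0 ≤ (1 / (2 * k)) ^ α := by positivity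
        linarith
      · have := Real.rpow_le_rpow_of_nonpos (by positivity) hxl h
        have h' : 0 ≤ (1 / k) ^ α := by positivity
        linarith
    have h2α : 0 ≤ 2 * (α + 1) := by linarith
    have hmain : ρ * (1 - ρ ^ 2) ^ α * circleAverage (fun z => ‖F (Φ z)‖ ^ 2) 0 ρ ≤
        R * (D * (1 - R ^ 2) ^ α) * (E * J R) := by
      have := hJ0 R
      have : 0 ≤ (1 - ρ ^ 2) ^ α := by positivity
      have : 0 ≤ circleAverage (fun z => ‖F (Φ z)‖ ^ 2) 0 ρ :=
        Real.circleAverage_nonneg_of_nonneg fun z _ => by positivity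
      gcongr
    calc _ ≤ 2 * (α + 1) * (R * (D * (1 - R ^ 2) ^ α) * (E * J R)) :=
          mul_le_mul_of_nonneg_left hmain h2α
      _ = _ := by ring
  calc _ ≤ ∫⁻ ρ in Set.Ioo (0 : ℝ) 1, ENNReal.ofReal (E * D) *
        ENNReal.ofReal (2 * (α + 1) * ((1 - k * (1 - ρ)) * (1 - (1 - k * (1 - ρ)) ^ 2) ^ α *
          J (1 - k * (1 - ρ)))) := by
        refine setLIntegral_mono_ae' measurableSet_Ioo (.of_forall fun ρ hρ => ?_)
        rw [← ENNReal.ofReal_mul (by positivity)]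
        exact ENNReal.ofReal_le_ofReal (hpt ρ hρ)
    _ = ENNReal.ofReal (E * D) * ∫⁻ ρ in Set.Ioo (0 : ℝ) 1,
        ENNReal.ofReal (2 * (α + 1) * ((1 - k * (1 - ρ)) * (1 - (1 - k * (1 - ρ)) ^ 2) ^ α *
          J (1 - k * (1 - ρ)))) := lintegral_const_mul' _ _ ENNReal.ofReal_ne_top
    _ ≤ ENNReal.ofReal (E * D) * (ENNReal.ofReal k⁻¹ * ∫⁻ ρ in Set.Ioo (0 : ℝ) 1,
        ENNReal.ofReal (2 * (α + 1) * (ρ * (1 - ρ ^ 2) ^ α * J ρ))) := by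
        gcongr
        exact lintegral_comp_affine_le hk0 hk1
          fun ρ => ENNReal.ofReal (2 * (α + 1) * (ρ * (1 - ρ ^ 2) ^ α * J ρ))
    _ = _ := by
        rw [← mul_assoc, ← ENNReal.ofReal_mul (by positivity)]
        rfl

end littlewood

section compOp

variable (Φ : Disc → Disc) (hΦ : IsAnalytic fun z => (Φ z : ℂ))

variable {α H}

theorem lintegral_comp_le [hα : Fact (-1 < α)] {Φ : Disc → Disc}
    (hΦ : IsAnalytic fun z => (Φ z : ℂ)) :
    ∃ C : ℝ≥0, ∀ f : BergmanSpace α H, IsAnalytic (fun z => f (Φ z)) ∧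
      ∫⁻ z, ‖f (Φ z)‖ₑ ^ 2 ∂areaMeasure α ≤ C * ‖f‖ₑ ^ 2 := by
  set Ψ : ℂ → ℂ := extend fun z => (Φ z : ℂ) with hΨ
  have hΨd : DifferentiableOn ℂ Ψ (Metric.ball 0 1) := hΦ.differentiableOn
  have hΨc : ∀ z : Disc, Ψ z = Φ z := extend_coe _
  have hmaps : ∀ z ∈ Metric.ball (0 : ℂ) 1, ‖Ψ z‖ < 1 := fun z hz => by
    have := hΨc ⟨z, hz⟩
    rw [this]
    exact mem_ball_zero_iff.1 (Φ ⟨z, hz⟩).2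
  obtain ⟨C, hC⟩ := exists_comp_bound hα.out hΨd hmaps
  refine ⟨C, fun f => ⟨?_, ?_⟩⟩
  · refine isAnalytic_of_differentiableOn (F := fun z => extend f (Ψ z))
      (f.isAnalytic.differentiableOn.comp hΨd fun z hz => by simpa using hmaps z hz) fun z => ?_
    rw [hΨc, extend_coe]
  · have := hC (extend f) f.isAnalytic.differentiableOn
    simp only [hΨc, extend_coe] at this
    rwa [BergmanSpace.enorm_sq_eq]

theorem integrable_comp [Fact (-1 < α)] (f : BergmanSpace α H) {Φ : Disc → Disc}
    (hΦ : IsAnalytic fun z => (Φ z : ℂ)) :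
    IsAnalytic (fun z => f (Φ z)) ∧
      Integrable (fun z => ‖f (Φ z)‖ ^ 2) (areaMeasure α) := by
  obtain ⟨C, hC⟩ := lintegral_comp_le (α := α) (H := H) hΦ
  refine ⟨(hC f).1, ((hC f).1.continuous.norm.pow 2).aestronglyMeasurable, ?_⟩
  refine lt_of_le_of_lt (le_of_eq ?_) ((hC f).2.trans_lt (by finiteness))
  exact lintegral_congr fun z => by simp [enorm_pow]

variable (α H)

/-- The composition operator `C_Φ f = f ∘ Φ` on `A²_α(H)` as a bounded linear operator, for an
analytic self-map `Φ` of the disc. -/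
def compOp [Fact (-1 < α)] : BergmanSpace α H →L[ℂ] BergmanSpace α H :=
  LinearMap.mkContinuousOfExistsBound
    { toFun := fun f => BergmanSpace.mk (fun z => f (Φ z)) (integrable_comp f hΦ).1
        (integrable_comp f hΦ).2
      map_add' := fun _ _ => rfl
      map_smul' := fun _ _ => rfl }
    (by
      obtain ⟨C, hC⟩ := lintegral_comp_le (α := α) (H := H) hΦ
      refine ⟨Real.sqrt C, fun f => ?_⟩
      set g := BergmanSpace.mk (α := α) (fun z => f (Φ z)) (integrable_comp f hΦ).1
        (integrable_comp f hΦ).2 with hg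
      change ‖g‖ ≤ _
      have h : ‖g‖ₑ ^ 2 ≤ C * ‖f‖ₑ ^ 2 := by
        rw [BergmanSpace.enorm_sq_eq g]
        exact (hC f).2
      have h2 : ‖g‖ ^ 2 ≤ C * ‖f‖ ^ 2 := by
        have h3 := ENNReal.toReal_mono (by finiteness) h
        simpa using h3
      refine abs_le_of_sq_le_sq' ?_ (by positivity) |>.2
      calc ‖g‖ ^ 2 ≤ C * ‖f‖ ^ 2 := h2
        _ = (Real.sqrt C * ‖f‖) ^ 2 := by rw [mul_pow, Real.sq_sqrt C.coe_nonneg])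

theorem compOp_apply [Fact (-1 < α)] (f : BergmanSpace α H) (z : Disc) :
    compOp α H Φ hΦ f z = f (Φ z) := rfl

end compOp

/-- A bounded operator `T` on a Hilbert space is a co-isometry if `T T* = I`. -/
def IsCoisometry {Y : Type*} [NormedAddCommGroup Y] [InnerProductSpace ℂ Y] [CompleteSpace Y]
    (T : Y →L[ℂ] Y) : Prop :=
  T ∘L ContinuousLinearMap.adjoint T = ContinuousLinearMap.id ℂ Y

end Bergman

end

/-! Rotations give unitary operators because the Bergman norm is rotation invariant and the inverse
rotation supplies an inverse operator. A unitary operator is a co-isometry, so all the remaining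
content is that a co-isometric `C_Φ` forces `Φ` to be a rotation (`IsCoisometry.exists_rotation`).

Let `T = C_Φ` with `T T* = I`. Then `T*` is isometric and `T` is a contraction. Two facts about the
norm are used: it is rotation invariant, and the first Taylor term of a function vanishing to order
`n` at the origin has norm at most that of the function (`norm_monomial_le`). Both are proved circle
by circle in polar coordinates, so neither orthonormal bases nor explicit moments are needed.

The symbol fixes the origin (`IsCoisometry.map_zero_eq_zero`): with `a = Φ 0` and `v ≠ 0`, the
constant term of `T ((1 + c z) v)` is `(1 + c a) v`. Contractivity therefore bounds `|1 + c a|²` by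
`1 + O(|c|²)`. If `a ≠ 0`, a small `c` in the direction of the conjugate of `a` violates this at
first order.

The derivative is extremal: `f = T* (z v)` satisfies `f ∘ Φ = z v` and `‖f‖ = ‖z v‖`. Since `f 0 =
0`, the norm of `f' 0` is at most `‖v‖`, while the chain rule at `0` gives `Φ' 0 • f' 0 = v`. Hence
`|Φ' 0| ≥ 1`, and the equality case of the Schwarz lemma makes `Φ` a rotation. -/

noncomputable section

namespace Bergman

open MeasureTheory Complex Filter Topology
open scoped ENNReal NNReal

open Real (circleAverage)

/-! ### Weighted means over circles: mean value inequality, rotation invariance, finite mass. -/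

section weightedMeans

variable {X : Type*} [NormedAddCommGroup X] [NormedSpace ℂ X] [CompleteSpace X] {α : ℝ}

theorem norm_sq_zero_le_circleAverage {G : ℂ → X} {ρ : ℝ} (hρ : 0 < ρ)
    (hG : DifferentiableOn ℂ G (Metric.closedBall 0 ρ)) :
    ‖G 0‖ ^ 2 ≤ circleAverage (fun z => ‖G z‖ ^ 2) 0 ρ := by
  have hd : DiffContOnCl ℂ G (Metric.ball 0 ρ) :=
    DifferentiableOn.diffContOnCl (by rwa [closure_ball _ hρ.ne'])
  refine (norm_sq_le_poisson hρ hd (Metric.mem_ball_self hρ)).trans (le_of_eq ?_)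
  -- At the centre `w = 0` the Herglotz–Riesz kernel is `z / z = 1`, so the Poisson average is the
  -- plain circle average.
  refine Real.circleAverage_congr_sphere fun z hz => ?_
  have hz0 : z ≠ 0 := by
    rintro rfl
    rw [mem_sphere_zero_iff_norm, norm_zero] at hz
    exact hρ.ne (by rwa [abs_of_pos hρ] at hz)
  simp [herglotzRieszKernel, div_self hz0]

/-- A weighted mean value inequality for `‖zⁿ G z‖²`. -/
theorem lintegral_pow_smul_apply_zero_le (hα : -1 < α) {G : ℂ → X}
    (hG : DifferentiableOn ℂ G (Metric.ball 0 1)) (n : ℕ) :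
    ∫⁻ z : Disc, ‖(z : ℂ) ^ n • G 0‖ₑ ^ 2 ∂areaMeasure α ≤
      ∫⁻ z : Disc, ‖(z : ℂ) ^ n • G z‖ₑ ^ 2 ∂areaMeasure α := by
  -- `|zⁿ|²` is constant on each circle and leaves the average. What remains is to compare `‖G 0‖²`
  -- with the mean of `‖G‖²` over each circle.
  have hpull : ∀ (K : ℂ → X) (ρ : ℝ), circleAverage (fun z => ‖z ^ n • K z‖ ^ 2) 0 ρ =
      (|ρ| ^ n) ^ 2 * circleAverage (fun z => ‖K z‖ ^ 2) 0 ρ := by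
    intro K ρ
    rw [← smul_eq_mul, ← Real.circleAverage_fun_smul]
    refine Real.circleAverage_congr_sphere fun z hz => ?_
    rw [mem_sphere_zero_iff_norm] at hz
    simp [norm_smul, mul_pow, hz]
  rw [lintegral_eq_polar hα (G := fun z => z ^ n • G 0) (by fun_prop),
    lintegral_eq_polar hα (G := fun z => z ^ n • G z)
      ((continuous_pow n).continuousOn.smul hG.continuousOn)]
  refine setLIntegral_mono_ae' measurableSet_Ioo (.of_forall fun ρ hρ => ?_)
  refine ENNReal.ofReal_le_ofReal ?_
  have hρ2 : 0 < 1 - ρ ^ 2 := by nlinarith [hρ.1, hρ.2]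
  have hα' : 0 ≤ 2 * (α + 1) := by linarith
  have := hρ.1.le
  have key := norm_sq_zero_le_circleAverage hρ.1
    (hG.mono (Metric.closedBall_subset_ball hρ.2))
  rw [hpull, hpull, Real.circleAverage_const]
  gcongr

/-- The Bergman norm is invariant under rotations. -/
theorem lintegral_comp_rotation (hα : -1 < α) {G : ℂ → X}
    (hG : ContinuousOn G (Metric.ball 0 1)) {c : ℂ} (hc : ‖c‖ = 1) :
    ∫⁻ z : Disc, ‖G (c * z)‖ₑ ^ 2 ∂areaMeasure α = ∫⁻ z : Disc, ‖G z‖ₑ ^ 2 ∂areaMeasure α := by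
  obtain ⟨η, rfl⟩ := (Complex.norm_eq_one_iff c).1 hc
  have hmaps : Set.MapsTo (fun z : ℂ => exp (η * I) * z) (Metric.ball 0 1) (Metric.ball 0 1) :=
    fun z hz => by simpa [hc] using hz
  rw [lintegral_eq_polar hα (G := fun z => G (exp (η * I) * z))
      (hG.comp (by fun_prop) hmaps), lintegral_eq_polar hα hG]
  -- A rotation shifts the angle by `η`, and the integral over a full period does not depend on its
  -- starting point.
  have : ∀ ρ : ℝ, circleAverage (fun z => ‖G (exp (η * I) * z)‖ ^ 2) 0 ρ =
      circleAverage (fun z => ‖G z‖ ^ 2) 0 ρ := by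
    intro ρ
    rw [Real.circleAverage_eq_integral_add (f := fun z => ‖G z‖ ^ 2) η, Real.circleAverage_def]
    have h : ∀ θ : ℝ, circleMap 0 ρ (θ + η) = exp (η * I) * circleMap 0 ρ θ := fun θ => by
      simp only [circleMap_zero]
      push_cast
      rw [add_mul, Complex.exp_add]
      ring
    simp only [h]
  simp only [this]

/-- Needed so that the bounded functions `zⁿ v` are square integrable. The radial density is the
derivative of `-(1 - ρ²) ^ (α + 1)`, which is continuous up to `ρ = 1` because `α + 1 > 0`; this
also covers `α < 0`, where the density is unbounded. -/
theorem isFiniteMeasure_areaMeasure (hα : -1 < α) : IsFiniteMeasure (areaMeasure α) := by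
  have h := lintegral_eq_polar (X := ℂ) hα (G := fun _ => 1) continuousOn_const
  simp only [enorm_one, one_pow, lintegral_const, one_mul, norm_one, Real.circleAverage_const,
    mul_one] at h
  refine ⟨h ▸ ?_⟩
  have hpos : ∀ ρ ∈ Set.Ioo (0 : ℝ) 1, 0 < 1 - ρ ^ 2 := fun ρ hρ => by nlinarith [hρ.1, hρ.2]
  have hi : IntegrableOn (fun ρ : ℝ => 2 * (α + 1) * (ρ * (1 - ρ ^ 2) ^ α)) (Set.Ioc 0 1) := by
    refine intervalIntegral.integrableOn_deriv_of_nonneg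
      (g := fun ρ : ℝ => -(1 - ρ ^ 2) ^ (α + 1)) ?_ (fun ρ hρ => ?_) fun ρ hρ => ?_
    · refine ContinuousOn.neg (ContinuousOn.rpow_const (by fun_prop) fun _ _ => Or.inr ?_)
      linarith
    · have h1 : HasDerivAt (fun ρ : ℝ => 1 - ρ ^ 2) (-(2 * ρ)) ρ := by
        simpa using (hasDerivAt_pow 2 ρ).const_sub 1
      refine (h1.rpow_const (p := α + 1) (Or.inl (hpos ρ hρ).ne')).neg.congr_deriv ?_
      rw [add_sub_cancel_right]
      ring
    · have := hpos ρ hρ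
      have := hρ.1
      have : 0 < α + 1 := by linarith
      positivity
  exact ((hi.mono_set Set.Ioo_subset_Ioc_self).lintegral_lt_top)

end weightedMeans

variable {α : ℝ} {H : Type*} [NormedAddCommGroup H] [InnerProductSpace ℂ H] [CompleteSpace H]
  [hα : Fact (-1 < α)]

/-! ### Vector monomials and their norms. -/

namespace BergmanSpace

variable (α) in
/-- The function `zⁿ v` as an element of the Bergman space. -/
def monomial (n : ℕ) (v : H) : BergmanSpace α H :=
  mk (fun z => (z : ℂ) ^ n • v)
    (isAnalytic_of_differentiableOn (F := fun z => z ^ n • v) (by fun_prop) fun _ => rfl)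
    (by
      have := isFiniteMeasure_areaMeasure hα.out
      refine Integrable.of_bound (C := ‖v‖ ^ 2)
        (by fun_prop : Continuous fun z : Disc => ‖(z : ℂ) ^ n • v‖ ^ 2).aestronglyMeasurable
        (.of_forall fun z => ?_)
      have hz : ‖(z : ℂ)‖ ≤ 1 := (mem_ball_zero_iff.1 z.2).le
      rw [norm_pow, norm_norm, norm_smul, norm_pow]
      gcongr
      exact mul_le_of_le_one_left (norm_nonneg _) (pow_le_one₀ (norm_nonneg _) hz))

theorem monomial_apply (n : ℕ) (v : H) (z : Disc) : monomial α n v z = (z : ℂ) ^ n • v := rfl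

theorem monomial_smul (n : ℕ) (c : ℂ) (v : H) : monomial α n (c • v) = c • monomial α n v :=
  ext fun z => by simp only [smul_apply, monomial_apply, smul_comm c]

theorem monomial_ne_zero (n : ℕ) {v : H} (hv : v ≠ 0) : monomial α n v ≠ 0 := by
  intro h
  have h1 := DFunLike.congr_fun h (⟨1 / 2, by norm_num⟩ : Disc)
  rw [monomial_apply, zero_apply] at h1
  simp [hv] at h1

/-- The moment on the right depends only on `n` and `α`, so it cancels when two monomials of equal
degree are compared. -/
theorem norm_monomial_eq (n : ℕ) (v : H) :
    ‖monomial α n v‖ ^ 2 = ‖v‖ ^ 2 * ∫ z : Disc, (‖(z : ℂ)‖ ^ n) ^ 2 ∂areaMeasure α := by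
  rw [norm_sq_eq, ← integral_const_mul]
  refine integral_congr_ae (.of_forall fun z => ?_)
  simp [monomial_apply, norm_smul, mul_pow, mul_comm]

/-- The assumption `v ≠ 0` serves to show that the common moment is positive, without computing it.
-/
theorem norm_le_of_norm_monomial_le {n : ℕ} {u v : H} (hv : v ≠ 0)
    (h : ‖monomial α n u‖ ≤ ‖monomial α n v‖) : ‖u‖ ≤ ‖v‖ := by
  have h1 : ‖monomial α n u‖ ^ 2 ≤ ‖monomial α n v‖ ^ 2 := by gcongr
  have h2 : 0 < ‖monomial α n v‖ ^ 2 := by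
    have := norm_pos_iff.2 (monomial_ne_zero (α := α) n hv)
    positivity
  rw [norm_monomial_eq] at h2
  rw [norm_monomial_eq, norm_monomial_eq] at h1
  have h3 := pos_of_mul_pos_right h2 (by positivity)
  exact (pow_le_pow_iff_left₀ (norm_nonneg _) (norm_nonneg _) two_ne_zero).1
    (le_of_mul_le_mul_right h1 h3)

/-- If `f z = zⁿ G z` with `G` holomorphic then the first Taylor term of `f` has norm at most that
of `f`. -/
theorem norm_monomial_le (f : BergmanSpace α H) {n : ℕ} {G : ℂ → H}
    (hG : DifferentiableOn ℂ G (Metric.ball 0 1)) (h : ∀ z : Disc, f z = (z : ℂ) ^ n • G z) :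
    ‖monomial α n (G 0)‖ ≤ ‖f‖ := by
  have key := lintegral_pow_smul_apply_zero_le hα.out hG n
  simp only [← h, ← monomial_apply (α := α)] at key
  rw [← enorm_sq_eq, ← enorm_sq_eq, ENNReal.pow_le_pow_left_iff two_ne_zero] at key
  exact enorm_le_iff_norm_le.1 key

end BergmanSpace

/-! ### Rotations induce unitary operators. -/

open BergmanSpace ContinuousLinearMap

variable {Φ : Disc → Disc} {hΦ : IsAnalytic fun z => (Φ z : ℂ)}

theorem norm_compOp_rotation {c : ℂ} (hc : ‖c‖ = 1) (h : ∀ z, (Φ z : ℂ) = c * z)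
    (f : BergmanSpace α H) : ‖compOp α H Φ hΦ f‖ = ‖f‖ := by
  have key := lintegral_comp_rotation hα.out f.isAnalytic.differentiableOn.continuousOn hc
  simp only [← h, extend_coe] at key
  have h1 : ‖compOp α H Φ hΦ f‖ₑ ^ 2 = ‖f‖ₑ ^ 2 := by
    rw [enorm_sq_eq, enorm_sq_eq]
    exact key
  have h2 : ‖compOp α H Φ hΦ f‖ ^ 2 = ‖f‖ ^ 2 := by
    simpa using congrArg ENNReal.toReal h1
  exact (pow_left_inj₀ (norm_nonneg _) (norm_nonneg _) two_ne_zero).1 h2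

theorem compOp_mem_unitary_of_rotation {c : ℂ} (hc : ‖c‖ = 1) (h : ∀ z, (Φ z : ℂ) = c * z) :
    compOp α H Φ hΦ ∈ unitary (BergmanSpace α H →L[ℂ] BergmanSpace α H) := by
  have hmem : ∀ z : Disc, c⁻¹ * (z : ℂ) ∈ Metric.ball (0 : ℂ) 1 := fun z => by
    simpa [hc] using mem_ball_zero_iff.1 z.2
  set Ψ : Disc → Disc := fun z => ⟨c⁻¹ * z, hmem z⟩
  have hΨ : IsAnalytic fun z => (Ψ z : ℂ) :=
    isAnalytic_of_differentiableOn (F := fun z => c⁻¹ * z) (by fun_prop) fun _ => rfl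
  have hc0 : c ≠ 0 := norm_ne_zero_iff.1 (by simp [hc])
  set T := compOp α H Φ hΦ
  set S := compOp α H Ψ hΨ
  have h1 : adjoint T * T = 1 := (norm_map_iff_adjoint_comp_self T).1 (norm_compOp_rotation hc h)
  -- Composition operators multiply in reverse order: `T * S` is composition with `Ψ ∘ Φ`.
  have h2 : T * S = 1 := ContinuousLinearMap.ext fun f => BergmanSpace.ext fun z => by
    change f (Ψ (Φ z)) = f z
    congr 1
    exact Subtype.ext (by simp only [Ψ, h, inv_mul_cancel_left₀ hc0])
  -- The left inverse `T*` and the right inverse `S` must coincide, which gives `T T* = 1`.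
  refine Unitary.mem_iff.2 ⟨h1, ?_⟩
  rw [star_eq_adjoint, left_inv_eq_right_inv h1 h2, h2]

/-! ### Co-isometric composition operators come from rotations. -/

theorem IsCoisometry.norm_adjoint_apply {Y : Type*} [NormedAddCommGroup Y]
    [InnerProductSpace ℂ Y] [CompleteSpace Y] {T : Y →L[ℂ] Y} (hT : IsCoisometry T) (y : Y) :
    ‖adjoint T y‖ = ‖y‖ :=
  (norm_map_iff_adjoint_comp_self (adjoint T)).2 (by rw [adjoint_adjoint]; exact hT) y

/-- `T` has the same operator norm as its isometric adjoint. -/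
theorem IsCoisometry.norm_apply_le {Y : Type*} [NormedAddCommGroup Y]
    [InnerProductSpace ℂ Y] [CompleteSpace Y] {T : Y →L[ℂ] Y} (hT : IsCoisometry T) (y : Y) :
    ‖T y‖ ≤ ‖y‖ := by
  have h : ‖T‖ ≤ 1 := by
    rw [← (adjoint (𝕜 := ℂ) (E := Y) (F := Y)).norm_map T]
    exact opNorm_le_bound _ zero_le_one fun x => by rw [hT.norm_adjoint_apply, one_mul]
  simpa using T.le_of_opNorm_le h y

/-- A co-isometric composition operator has a symbol fixing the origin. -/
theorem IsCoisometry.map_zero_eq_zero [Nontrivial H] (hT : IsCoisometry (compOp α H Φ hΦ))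
    (o : Disc) (ho : (o : ℂ) = 0) : (Φ o : ℂ) = 0 := by
  obtain ⟨v, hv⟩ := exists_ne (0 : H)
  set a : ℂ := (Φ o : ℂ)
  set N := ‖monomial α 0 v‖ ^ 2
  set M := ‖monomial α 1 v‖ ^ 2
  have hN : 0 < N := by
    have := norm_pos_iff.2 (monomial_ne_zero (α := α) 0 hv)
    positivity
  have hneg : IsAnalytic fun z : Disc => ((-z : Disc) : ℂ) :=
    isAnalytic_of_differentiableOn (F := fun z => -z) (by fun_prop) fun _ => rfl
  -- Contractivity of `C_Φ` tested on `(1 + c z) v`.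
  have key : ∀ c : ℂ, N * ‖1 + c * a‖ ^ 2 ≤ N + ‖c‖ ^ 2 * M := by
    intro c
    set f : BergmanSpace α H := monomial α 0 v + c • monomial α 1 v with hf
    have hval : ∀ z : Disc, f z = (1 + c * (z : ℂ)) • v := fun z => by
      rw [hf, BergmanSpace.add_apply, BergmanSpace.smul_apply, monomial_apply,
        monomial_apply, pow_zero, pow_one, add_smul,
        mul_smul]
    -- Pythagoras without an inner product computation: `z ↦ -z` preserves the norm and turns `p +
    -- q` into `p - q`, so the parallelogram law yields `‖p + q‖² = ‖p‖² + ‖q‖²`.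
    have hfn : ‖f‖ ^ 2 = N + ‖c‖ ^ 2 * M := by
      have h1 := norm_compOp_rotation (hΦ := hneg) (c := -1) (by simp) (by simp) f
      have h2 : compOp α H _ hneg f = monomial α 0 v - c • monomial α 1 v :=
        BergmanSpace.ext fun z => by
          rw [compOp_apply, hval, BergmanSpace.sub_apply, BergmanSpace.smul_apply, monomial_apply,
            monomial_apply, add_smul,
            mul_smul]
          simp [sub_eq_add_neg]
      have h3 := parallelogram_law_with_norm ℂ (monomial α 0 v) (c • monomial α 1 v)
      rw [← h2, h1, ← hf, norm_smul] at h3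
      simp only [N, M]
      linarith
    -- With `n = 0`, the norm of the constant function with value `f (Φ 0) = (1 + c a) v` is at most
    -- that of `f ∘ Φ`.
    have h1 := norm_monomial_le (compOp α H Φ hΦ f) (n := 0)
      (compOp α H Φ hΦ f).isAnalytic.differentiableOn fun z => by
        rw [extend_coe, pow_zero, one_smul]
    rw [← ho, extend_coe, compOp_apply, hval, monomial_smul, norm_smul] at h1
    have h2 := pow_le_pow_left₀ (by positivity) (h1.trans (hT.norm_apply_le f)) 2
    rw [hfn, mul_pow] at h2
    linarith
  by_contra ha
  have hA : 0 < ‖a‖ ^ 2 := by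
    have := norm_pos_iff.2 ha
    positivity
  set A := ‖a‖ ^ 2
  have hM : 0 ≤ M := by positivity
  -- Any `t > 0` with `t M ≤ N` would do: the error `t² A M` is then at most `t A N`, half of the
  -- first-order gain `2 t A N`. Adding `1` keeps the denominator positive from `M ≥ 0` alone.
  set t : ℝ := N / (M + 1) with ht
  have ht0 : 0 < t := by positivity
  -- This direction makes `c a = t |a|²` real and positive.
  have h1 := key (t * (starRingEnd ℂ) a)
  have h2 : (1 : ℂ) + t * (starRingEnd ℂ) a * a = ((1 + t * A : ℝ) : ℂ) := by
    rw [mul_assoc, mul_comm _ a, Complex.mul_conj']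
    push_cast [A]
    rfl
  rw [h2, norm_real, Real.norm_eq_abs, sq_abs, norm_mul, norm_real, RCLike.norm_conj, mul_pow,
    Real.norm_eq_abs, sq_abs] at h1
  change N * (1 + t * A) ^ 2 ≤ N + t ^ 2 * A * M at h1
  have h3 : t * M ≤ N := by
    have : t * (M + 1) = N := by rw [ht]; field_simp
    linarith
  have h4 : t ^ 2 * A * M ≤ t * A * N := by
    calc t ^ 2 * A * M = t * A * (t * M) := by ring
      _ ≤ t * A * N := by gcongr
  have h5 : 0 < t * A * N := by positivity
  nlinarith [mul_pos h5 (mul_pos ht0 hA)]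

theorem IsCoisometry.exists_rotation [Nontrivial H] (hT : IsCoisometry (compOp α H Φ hΦ)) :
    ∃ c : ℂ, ‖c‖ = 1 ∧ ∀ z : Disc, (Φ z : ℂ) = c * z := by
  obtain ⟨v, hv⟩ := exists_ne (0 : H)
  set o : Disc := ⟨0, by simp⟩
  set Ψ : ℂ → ℂ := extend fun z => (Φ z : ℂ)
  have hΨd : DifferentiableOn ℂ Ψ (Metric.ball 0 1) := hΦ.differentiableOn
  have hΨc : ∀ z : Disc, Ψ z = Φ z := extend_coe _
  have hΨ0 : Ψ 0 = 0 := (hΨc o).trans (hT.map_zero_eq_zero o rfl)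
  have hnhds : Metric.ball (0 : ℂ) 1 ∈ 𝓝 0 := Metric.ball_mem_nhds 0 one_pos
  have hmaps : Set.MapsTo Ψ (Metric.ball 0 1) (Metric.closedBall (Ψ 0) 1) := fun z hz => by
    rw [hΨ0, show Ψ z = Φ ⟨z, hz⟩ from hΨc ⟨z, hz⟩]
    exact Metric.ball_subset_closedBall (Φ ⟨z, hz⟩).2
  set f := adjoint (compOp α H Φ hΦ) (monomial α 1 v)
  -- This is `T T* = I` applied to `z v` and evaluated at a point.
  have hfΦ : ∀ z : Disc, f (Φ z) = (z : ℂ) • v := fun z => by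
    have := DFunLike.congr_fun (DFunLike.congr_fun hT (monomial α 1 v)) z
    rw [← pow_one (z : ℂ)]
    exact this
  set F : ℂ → H := extend f
  have hFd : DifferentiableOn ℂ F (Metric.ball 0 1) := f.isAnalytic.differentiableOn
  have hF0 : F 0 = 0 := by
    have h1 := hfΦ o
    rw [zero_smul, ← extend_coe f, ← hΨc] at h1
    rwa [show ((o : Disc) : ℂ) = 0 from rfl, hΨ0] at h1
  -- Since `F 0 = 0`, `F z = z • dslope F 0 z`, and the slope at `0` is `F' 0`. Its monomial has
  -- norm at most `‖f‖ = ‖z v‖`, as `T*` is isometric.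
  have hle : ‖deriv F 0‖ ≤ ‖v‖ := by
    have h1 := norm_monomial_le f (n := 1) (G := dslope F 0)
      ((differentiableOn_dslope hnhds).2 hFd) fun z => by
        have := sub_smul_dslope F 0 (z : ℂ)
        rw [sub_zero, hF0, sub_zero] at this
        rw [pow_one, this]
        exact (extend_coe f z).symm
    rw [dslope_same, hT.norm_adjoint_apply] at h1
    exact norm_le_of_norm_monomial_le hv h1
  -- Differentiating `F ∘ Ψ = z v` at `0`, where `Ψ 0 = 0`.
  have hchain : deriv Ψ 0 • deriv F 0 = v := by
    have h1 : HasDerivAt Ψ (deriv Ψ 0) 0 := (hΨd.differentiableAt hnhds).hasDerivAt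
    have h2 : HasDerivAt F (deriv F 0) (Ψ 0) := by
      rw [hΨ0]
      exact (hFd.differentiableAt hnhds).hasDerivAt
    have h3 : HasDerivAt (fun z : ℂ => z • v) v 0 := by
      simpa using (hasDerivAt_id (0 : ℂ)).smul_const v
    refine (h2.scomp 0 h1).unique (h3.congr_of_eventuallyEq ?_)
    filter_upwards [hnhds] with z hz
    have := hfΦ ⟨z, hz⟩
    rwa [← extend_coe f, ← hΨc] at this
  -- The upper bound is the Schwarz lemma, and `1 / 1` is its ratio of radii. If `|Ψ' 0| < 1`, then
  -- `hchain` and `hle` would give `‖v‖ < ‖v‖`.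
  have hone : ‖dslope Ψ 0 0‖ = 1 / 1 := by
    refine le_antisymm (norm_dslope_le_div_of_mapsTo_ball hΨd hmaps (by simp)) ?_
    rw [dslope_same, div_one]
    have h1 := congrArg norm hchain
    rw [norm_smul] at h1
    have hv' := norm_pos_iff.2 hv
    by_contra! h
    nlinarith [norm_nonneg (deriv Ψ 0)]
  refine ⟨dslope Ψ 0 0, by rw [hone, div_one], fun z => ?_⟩
  -- Equality in the Schwarz lemma makes `Ψ` affine on the disc, with slope `Ψ' 0`.
  have := affine_of_mapsTo_ball_of_norm_dslope_eq_div hΨd hmaps (by simp) hone z.2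
  rw [← hΨc, this, hΨ0]
  simp [mul_comm]

theorem isCoisometry_of_mem_unitary {Y : Type*} [NormedAddCommGroup Y] [InnerProductSpace ℂ Y]
    [CompleteSpace Y] {T : Y →L[ℂ] Y} (hT : T ∈ unitary (Y →L[ℂ] Y)) : IsCoisometry T :=
  (Unitary.mem_iff.1 hT).2

end Bergman

end

theorem mainTheorem3 (α : ℝ) [Fact (-1 < α)]
    (H : Type*) [NormedAddCommGroup H] [InnerProductSpace ℂ H] [CompleteSpace H]
    [TopologicalSpace.SeparableSpace H] [Nontrivial H]
    (Φ : Bergman.Disc → Bergman.Disc) (hΦ : Bergman.IsAnalytic fun z => (Φ z : ℂ)) :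
    (Bergman.compOp α H Φ hΦ ∈
        unitary (Bergman.BergmanSpace α H →L[ℂ] Bergman.BergmanSpace α H) ↔
      ∃ c : ℂ, ‖c‖ = 1 ∧ ∀ z : Bergman.Disc, (Φ z : ℂ) = c * z) ∧
    (Bergman.IsCoisometry (Bergman.compOp α H Φ hΦ) ↔
      Bergman.compOp α H Φ hΦ ∈
        unitary (Bergman.BergmanSpace α H →L[ℂ] Bergman.BergmanSpace α H)) := by
  refine ⟨⟨fun h => (Bergman.isCoisometry_of_mem_unitary h).exists_rotation, ?_⟩,
    fun h => ?_, Bergman.isCoisometry_of_mem_unitary⟩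
  · rintro ⟨c, hc, h⟩
    exact Bergman.compOp_mem_unitary_of_rotation hc h
  · obtain ⟨c, hc, h⟩ := h.exists_rotation
    exact Bergman.compOp_mem_unitary_of_rotation hc h
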